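/- Let $F$ be a free group (of any rank) and let $H \le F$ be a finitely generated subgroup. An element $g \in F$ \emph{depends} on $H$ if it satisfies a nontrivial univariate equation over $H$, that is, if there is $w(x) \in H * F(x)$, $w(x) \neq 1$, such that $w(g) = 1$, where $F(x)$ is the free group on one generator $x$ and $w(g)$ is the image of $w(x)$ under the homomorphism $H * F(x) \to F$ which is the inclusion on $H$ and maps $x$ to $g$. Let $\mathrm{Dep}(H) \le F$ be the subgroup generated by all elements of $F$ that depend on $H$. Then $$\operatorname{rk} \mathrm{Dep}(H) \le \operatorname{rk} H,$$ where $\operatorname{rk}$ denotes the cardinality of a basis of a free group. (In particular $\mathrm{Dep}(H)$ is finitely generated.) -/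

import Mathlib

universe u

namespace FreeDependence

/-- Substitution `x ↦ g`: the homomorphism `H * F(x) → F` that is the inclusion on `H` and sends
the free generator `x` to `g`; its value at `w` is `w(g)`. Its image is the subgroup generated by
`H` and `g`. -/
def evalHom {F : Type*} [Group F] (H : Subgroup F) (g : F) :
    Monoid.Coprod H (FreeGroup Unit) →* F :=
  Monoid.Coprod.lift H.subtype (FreeGroup.lift (fun _ : Unit => g))

/-- `g` depends on `H`: it satisfies a (nontrivial) univariate equation `w(x) = 1`,
where `w(x) ∈ H * F(x)`. -/
def DependsOn {F : Type*} [Group F] (H : Subgroup F) (g : F) : Prop :=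
  ∃ w : Monoid.Coprod H (FreeGroup Unit), w ≠ 1 ∧ evalHom H g w = 1

/-- The set `dep H` of all elements that depend on `H`. -/
def depSet {F : Type*} [Group F] (H : Subgroup F) : Set F :=
  {g : F | DependsOn H g}

/-- The dependent subgroup `Dep H`, generated by the elements that depend on `H`. -/
def Dep {F : Type*} [Group F] (H : Subgroup F) : Subgroup F :=
  Subgroup.closure (depSet H)

/-- The rank of a free group: the cardinality of a basis (by `rk_eq_mk_basis`, of any basis). -/
noncomputable def rk (G : Type*) [Group G] [IsFreeGroup G] : Cardinal :=
  Cardinal.mk (IsFreeGroup.Generators G)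

theorem rk_eq_mk_basis {ι G : Type u} [Group G] [IsFreeGroup G] (b : FreeGroupBasis ι G) :
    rk G = Cardinal.mk ι :=
  Cardinal.mk_congr (Equiv.ofFreeGroupEquiv ((IsFreeGroup.basis G).repr.symm.trans b.repr))

theorem dependsOn_iff_not_injective {F : Type*} [Group F] (H : Subgroup F) (g : F) :
    DependsOn H g ↔ ¬ Function.Injective (evalHom H g) := by
  rw [injective_iff_map_eq_one]
  simp only [DependsOn, not_forall]
  constructor
  · rintro ⟨w, h1, h2⟩
    exact ⟨w, h2, h1⟩
  · rintro ⟨w, h2, h1⟩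
    exact ⟨w, h1, h2⟩

end FreeDependence

/-!
Call `n` the rank of `H`. If `g` depends on `H`, then `⟨H, g⟩` is a free group which is a proper
quotient of a free group of rank `n + 1`, so that its rank is at most `n`, finitely generated free
groups being Hopfian. An equation over `H` stays an equation over every larger subgroup, so elements
depending on `H` can be adjoined one after the other: every subgroup `⟨H, g₁, …, gₖ⟩` with all `gᵢ`
depending on `H` has rank at most `n`. The group `Dep H` is the directed union of these subgroups.
If its rank exceeded `n`, it would retract onto a free factor of rank `n + 1`, and one of these
subgroups, being large enough to contain a basis of that factor, would surject onto it, which is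
impossible.

Ranks are compared by counting homomorphisms to finite groups: a free group of rank `n` has
`|P| ^ n` homomorphisms to `P`, and a surjection `G → G'` embeds `Hom(G', P)` into `Hom(G, P)`
(`FreeGroupBasis.card_le_of_surjective`). When the ranks agree this embedding is a bijection for all
finite `P`, so the kernel dies in every finite quotient, and residual finiteness gives the Hopfian
property (`FreeGroupBasis.injective_of_surjective`).

That equations persist over larger subgroups amounts to the injectivity of `H * F(x) → K * F(x)`
for `H ≤ K`. Normal forms in free products are avoided: if `g` depends on the finitely generated
subgroup `H`, the drop in rank of `⟨H, g⟩` already provides an equation that is nontrivial in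
`H × F(x)` (`FreeDependence.DependsOn.exists_toProd_ne_one`), and `H × F(x)` visibly embeds into
`K × F(x)`.
-/

/-! ### Finitely generated free groups are residually finite and Hopfian -/

/-- Free groups are residually finite: a word acts nontrivially on the finite set of its suffixes
(viewed as group elements), once the partially defined left multiplications by the generators have
been extended to permutations of that set. -/
theorem FreeGroup.exists_hom_finite_apply_ne_one {α : Type u} (w : FreeGroup α) (hw : w ≠ 1) :
    ∃ (X : Type u) (_ : Finite X) (f : FreeGroup α →* Equiv.Perm X), f w ≠ 1 := by
  classical
  obtain ⟨L, rfl⟩ : ∃ L, FreeGroup.mk L = w := ⟨w.toWord, FreeGroup.mk_toWord⟩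
  let B : Finset (FreeGroup α) := (L.tails.map FreeGroup.mk).toFinset
  have hB : ∀ L', L' <:+ L → FreeGroup.mk L' ∈ B := fun L' h => by
    simp only [B, List.mem_toFinset, List.mem_map, List.mem_tails]
    exact ⟨L', h, rfl⟩
  -- `e a` is left multiplication by `a`, between the parts of `B` where it is defined.
  let e : ∀ a : α, {x : B // FreeGroup.of a * x.1 ∈ B} ≃ {x : B // (FreeGroup.of a)⁻¹ * x.1 ∈ B} :=
    fun a =>
      { toFun := fun x => ⟨⟨FreeGroup.of a * x.1.1, x.2⟩, by simp⟩
        invFun := fun x => ⟨⟨(FreeGroup.of a)⁻¹ * x.1.1, x.2⟩, by simp⟩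
        left_inv := fun x => by simp
        right_inv := fun x => by simp }
  let σ : α → Equiv.Perm B := fun a => (e a).extendSubtype
  have hσ : ∀ (a : α) (x y : B), (y : FreeGroup α) = FreeGroup.of a * x → σ a x = y := by
    intro a x y h
    have hx : FreeGroup.of a * x.1 ∈ B := h ▸ y.2
    rw [Equiv.extendSubtype_apply_of_mem (e a) x hx]
    exact Subtype.ext h.symm
  let f : FreeGroup α →* Equiv.Perm B := FreeGroup.lift σ
  have h1 : (1 : FreeGroup α) ∈ B := hB [] List.nil_suffix
  have key : ∀ L' (h : L' <:+ L), f (FreeGroup.mk L') ⟨1, h1⟩ = ⟨FreeGroup.mk L', hB L' h⟩ := by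
    intro L'
    induction L' with
    | nil =>
      intro h
      have hf1 : f (FreeGroup.mk []) = 1 := _root_.map_one f
      rw [hf1]
      rfl
    | cons p L' ih =>
      intro h
      have h' : L' <:+ L := (List.suffix_cons p L').trans h
      obtain ⟨a, b⟩ := p
      have hmk : FreeGroup.mk ((a, b) :: L') = FreeGroup.mk [(a, b)] * FreeGroup.mk L' := by
        rw [FreeGroup.mul_mk]; rfl
      have step : f (FreeGroup.mk ((a, b) :: L')) ⟨1, h1⟩ =
          f (FreeGroup.mk [(a, b)]) ⟨FreeGroup.mk L', hB L' h'⟩ := by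
        rw [hmk, _root_.map_mul, Equiv.Perm.mul_apply, ih h']
      rw [step]
      cases b with
      | true =>
        have : f (FreeGroup.mk [(a, true)]) = σ a := FreeGroup.lift_apply_of
        rw [this]
        exact hσ a _ _ hmk
      | false =>
        have hinv : FreeGroup.mk [(a, false)] = (FreeGroup.of a)⁻¹ := rfl
        have : f (FreeGroup.mk [(a, false)]) = (σ a)⁻¹ := by
          rw [hinv, _root_.map_inv]; exact congrArg _ FreeGroup.lift_apply_of
        rw [this, Equiv.Perm.inv_eq_iff_eq]
        refine (hσ a _ _ ?_).symm
        change FreeGroup.mk L' = FreeGroup.of a * FreeGroup.mk ((a, false) :: L')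
        rw [hmk, hinv, mul_inv_cancel_left]
  refine ⟨B, inferInstance, f, fun h => hw ?_⟩
  have := key L List.suffix_rfl
  rw [h] at this
  exact (congrArg Subtype.val this).symm

theorem MonoidHom.comp_right_injective_of_surjective {G G' : Type*} [Group G] [Group G']
    {φ : G →* G'} (hφ : Function.Surjective φ) (P : Type*) [Group P] :
    Function.Injective (fun f : G' →* P => f.comp φ) :=
  fun _ _ h => (MonoidHom.cancel_right hφ).1 h

namespace FreeGroupBasis

variable {ι κ G G' : Type*} [Group G] [Group G']

theorem finite_hom [Finite ι] (b : FreeGroupBasis ι G) (P : Type*) [Group P] [Finite P] :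
    Finite (G →* P) :=
  Finite.of_equiv _ b.lift

theorem card_hom [Finite ι] (b : FreeGroupBasis ι G) (P : Type*) [Group P] :
    Nat.card (G →* P) = Nat.card P ^ Nat.card ι := by
  rw [← Nat.card_congr (b.lift (H := P)), Nat.card_fun]

/-- The rank of a free group does not increase under surjections. Only homomorphisms to `ℤ/2` are
counted, so it suffices that `κ`-tuples in `ℤ/2` inject into `Hom(G', ℤ/2)`; in this form the lemma
also applies to groups `G'` that are not free. -/
theorem card_le_of_surjective_of_injective [Finite ι] (b : FreeGroupBasis ι G) {φ : G →* G'}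
    (hφ : Function.Surjective φ)
    {j : (κ → Multiplicative (ZMod 2)) → (G' →* Multiplicative (ZMod 2))}
    (hj : Function.Injective j) : Finite κ ∧ Nat.card κ ≤ Nat.card ι := by
  have : Finite (Multiplicative (ZMod 2)) := inferInstanceAs (Finite (ZMod 2))
  have : Nontrivial (Multiplicative (ZMod 2)) := inferInstanceAs (Nontrivial (ZMod 2))
  have hfin := b.finite_hom (Multiplicative (ZMod 2))
  have hinj := (MonoidHom.comp_right_injective_of_surjective hφ (Multiplicative (ZMod 2))).comp hj
  have hfun : Finite (κ → Multiplicative (ZMod 2)) := Finite.of_injective _ hinj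
  have hκ : Finite κ := by
    classical
    exact Finite.of_injective
      (fun k => Pi.mulSingle k (Multiplicative.ofAdd (1 : ZMod 2))) fun k l h => by
        by_contra hkl
        have := congrFun h k
        dsimp only at this
        rw [Pi.mulSingle_eq_same, Pi.mulSingle_eq_of_ne hkl] at this
        exact absurd this (by decide)
  refine ⟨hκ, ?_⟩
  have h := Nat.card_le_card_of_injective _ hinj
  rw [b.card_hom, Nat.card_fun] at h
  exact (Nat.pow_le_pow_iff_right Finite.one_lt_card).1 h

theorem card_le_of_surjective [Finite ι] (b : FreeGroupBasis ι G) (b' : FreeGroupBasis κ G')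
    {φ : G →* G'} (hφ : Function.Surjective φ) : Finite κ ∧ Nat.card κ ≤ Nat.card ι :=
  b.card_le_of_surjective_of_injective hφ b'.lift.injective

/-- Finitely generated free groups are Hopfian: a surjection between free groups of the same finite
rank is injective. -/
theorem injective_of_surjective [Finite ι] (b : FreeGroupBasis ι G) (b' : FreeGroupBasis κ G')
    {φ : G →* G'} (hφ : Function.Surjective φ) (hcard : Nat.card ι ≤ Nat.card κ) :
    Function.Injective φ := by
  obtain ⟨hκ, hle⟩ := b.card_le_of_surjective b' hφ
  rw [injective_iff_map_eq_one]
  intro g hg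
  by_contra hne
  obtain ⟨X, _, f, hf⟩ := FreeGroup.exists_hom_finite_apply_ne_one (b.repr g)
    fun h => hne ((map_eq_one_iff b.repr b.repr.injective).1 h)
  have := b.finite_hom (Equiv.Perm X)
  have hbij : Function.Bijective (fun f : G' →* Equiv.Perm X => f.comp φ) :=
    (Nat.bijective_iff_injective_and_card _).2
      ⟨MonoidHom.comp_right_injective_of_surjective hφ _, by
        rw [b.card_hom, b'.card_hom, le_antisymm hle hcard]⟩
  obtain ⟨f', hf'⟩ := hbij.2 (f.comp b.repr.toMonoidHom)
  apply hf
  have h := DFunLike.congr_fun hf' g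
  simpa [hg] using h.symm

end FreeGroupBasis

theorem IsFreeGroup.finite_generators (G : Type*) [Group G] [IsFreeGroup G] [Group.FG G] :
    Finite (IsFreeGroup.Generators G) := by
  obtain ⟨α, _, φ, hφ⟩ :=
    Group.fg_iff_exists_freeGroup_hom_surjective_finite.1 (inferInstance : Group.FG G)
  exact ((FreeGroupBasis.ofFreeGroup α).card_le_of_surjective (IsFreeGroup.basis G) hφ).1

theorem Subgroup.exists_finset_mem_closure {G : Type*} [Group G] {S : Set G} {x : G}
    (hx : x ∈ Subgroup.closure S) :
    ∃ T : Finset G, (T : Set G) ⊆ S ∧ x ∈ Subgroup.closure (T : Set G) := by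
  classical
  induction hx using Subgroup.closure_induction with
  | mem x hx => exact ⟨{x}, by simpa using hx, Subgroup.subset_closure (by simp)⟩
  | one => exact ⟨∅, by simp, one_mem _⟩
  | mul x y _ _ ihx ihy =>
    obtain ⟨T, hT, hx⟩ := ihx
    obtain ⟨U, hU, hy⟩ := ihy
    refine ⟨T ∪ U, by simp [hT, hU], mul_mem (Subgroup.closure_mono ?_ hx)
      (Subgroup.closure_mono ?_ hy)⟩ <;> simp
  | inv x _ ih =>
    obtain ⟨T, hT, hx⟩ := ih
    exact ⟨T, hT, inv_mem hx⟩

/-! ### Adjoining dependent elements -/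

namespace FreeDependence

open Monoid (Coprod)

variable {F : Type*} [Group F]

theorem range_evalHom (H : Subgroup F) (g : F) :
    (evalHom H g).range = H ⊔ Subgroup.closure {g} := by
  rw [evalHom, Monoid.Coprod.range_lift, Subgroup.range_subtype, FreeGroup.range_lift_eq_closure,
    Set.range_const]

theorem mem_depSet_of_mem {H : Subgroup F} {h : F} (hh : h ∈ H) : h ∈ depSet H := by
  refine ⟨Coprod.inl ⟨h, hh⟩ * (Coprod.inr (FreeGroup.of ()))⁻¹, fun hw => ?_, ?_⟩
  · have := congrArg (Coprod.snd : Coprod H (FreeGroup Unit) →* _) hw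
    simp at this
  · simp [evalHom]

theorem le_dep (H : Subgroup F) : H ≤ Dep H :=
  fun _ hh => Subgroup.subset_closure (mem_depSet_of_mem hh)

/-- Adjoining a dependent element does not increase the rank. -/
theorem DependsOn.card_le {H : Subgroup F} {g : F} (hg : DependsOn H g) {ι κ : Type*} [Finite ι]
    (b : FreeGroupBasis ι H) (b' : FreeGroupBasis κ (evalHom H g).range) :
    Finite κ ∧ Nat.card κ ≤ Nat.card ι := by
  -- `ψ` presents `H * F(x)` as a quotient of a free group of rank `rk H + 1`; it is in fact an
  -- isomorphism, but surjectivity suffices.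
  let ψ : FreeGroup (ι ⊕ Unit) →* Coprod H (FreeGroup Unit) :=
    FreeGroup.lift (Sum.elim (fun i => Coprod.inl (b i)) fun u => Coprod.inr (FreeGroup.of u))
  have hψ : Function.Surjective ψ := by
    rw [← MonoidHom.range_eq_top, eq_top_iff, ← Coprod.range_inl_sup_range_inr, sup_le_iff]
    constructor
    · let s : H →* FreeGroup (ι ⊕ Unit) := b.lift fun i => FreeGroup.of (Sum.inl i)
      have : ψ.comp s = Coprod.inl := b.ext_hom _ _ fun i => by simp [ψ, s]
      rw [← this]
      rintro _ ⟨x, rfl⟩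
      exact ⟨s x, rfl⟩
    · let s : FreeGroup Unit →* FreeGroup (ι ⊕ Unit) := FreeGroup.map Sum.inr
      have : ψ.comp s = Coprod.inr := by ext; simp [ψ, s]
      rw [← this]
      rintro _ ⟨x, rfl⟩
      exact ⟨s x, rfl⟩
  let φ := (evalHom H g).rangeRestrict.comp ψ
  have hφ : Function.Surjective φ := (evalHom H g).rangeRestrict_surjective.comp hψ
  obtain ⟨hκ, hle⟩ := (FreeGroupBasis.ofFreeGroup (ι ⊕ Unit)).card_le_of_surjective b' hφ
  refine ⟨hκ, ?_⟩
  by_contra! hlt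
  have hφinj : Function.Injective φ :=
    (FreeGroupBasis.ofFreeGroup (ι ⊕ Unit)).injective_of_surjective b' hφ (by
      rw [Nat.card_sum, Nat.card_unique (α := Unit)]; exact hlt)
  obtain ⟨w, hw, hw1⟩ := hg
  obtain ⟨v, rfl⟩ := hψ w
  have hv : φ v = 1 := Subtype.ext hw1
  rw [map_eq_one_iff φ hφinj] at hv
  exact hw (by rw [hv, map_one])

variable [IsFreeGroup F]

/-- An element that depends on a finitely generated subgroup `H` satisfies an equation which is
nontrivial already in `H × F(x)`. Otherwise `⟨H, g⟩` would surject onto `H × F(x)`, and would thus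
have rank greater than that of `H`. -/
theorem DependsOn.exists_toProd_ne_one {H : Subgroup F} (hH : H.FG) {g : F} (hg : DependsOn H g) :
    ∃ w : Coprod H (FreeGroup Unit), Coprod.toProd w ≠ 1 ∧ evalHom H g w = 1 := by
  by_contra! hcon
  have : Group.FG H := (Group.fg_iff_subgroup_fg H).2 hH
  have hfin := IsFreeGroup.finite_generators H
  let b := IsFreeGroup.basis H
  let b' := IsFreeGroup.basis (evalHom H g).range
  obtain ⟨hfin', hle⟩ := hg.card_le b b'
  let p : (evalHom H g).range →* H × FreeGroup Unit :=
    (evalHom H g).rangeRestrict.liftOfSurjective (evalHom H g).rangeRestrict_surjective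
      ⟨Coprod.toProd, fun w hw => by
        rw [MonoidHom.ker_rangeRestrict] at hw
        by_contra h
        exact hcon w h hw⟩
  have hp : Function.Surjective p := fun y => by
    obtain ⟨w, rfl⟩ := Coprod.toProd_surjective y
    exact ⟨(evalHom H g).rangeRestrict w, MonoidHom.liftOfRightInverse_comp_apply _ _ _ _ w⟩
  let j : (IsFreeGroup.Generators H ⊕ Unit → Multiplicative (ZMod 2)) →
      (H × FreeGroup Unit →* Multiplicative (ZMod 2)) := fun f =>
    (b.lift fun i => f (Sum.inl i)).coprod (FreeGroup.lift fun u => f (Sum.inr u))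
  have hj : Function.Injective j := by
    intro f f' h
    funext i
    cases i with
    | inl i => simpa [j] using DFunLike.congr_fun h (b i, 1)
    | inr u => simpa [j] using DFunLike.congr_fun h (1, FreeGroup.of u)
  have := (b'.card_le_of_surjective_of_injective hp hj).2
  rw [Nat.card_sum, Nat.card_unique (α := Unit)] at this
  omega

theorem DependsOn.mono {H K : Subgroup F} (hH : H.FG) (hHK : H ≤ K) {g : F}
    (hg : DependsOn H g) : DependsOn K g := by
  obtain ⟨w, hw, hw1⟩ := hg.exists_toProd_ne_one hH
  let m : Coprod H (FreeGroup Unit) →* Coprod K (FreeGroup Unit) :=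
    Coprod.map (Subgroup.inclusion hHK) (MonoidHom.id _)
  refine ⟨m w, fun h => hw ?_, ?_⟩
  · have hcomp : (Coprod.toProd.comp m) =
        ((Subgroup.inclusion hHK).prodMap (MonoidHom.id (FreeGroup Unit))).comp Coprod.toProd := by
      ext <;> simp [m]
    have h1 := DFunLike.congr_fun hcomp w
    rw [MonoidHom.comp_apply, MonoidHom.comp_apply, h, map_one] at h1
    have hinj : Function.Injective
        ((Subgroup.inclusion hHK).prodMap (MonoidHom.id (FreeGroup Unit))) :=
      Function.Injective.prodMap (Subgroup.inclusion_injective hHK) Function.injective_id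
    exact (map_eq_one_iff _ hinj).1 h1.symm
  · have hcomp : (evalHom K g).comp m = evalHom H g := by
      apply Coprod.hom_ext <;> ext <;> simp [m, evalHom]
    rw [← hw1, ← hcomp, MonoidHom.comp_apply]

theorem card_generators_sup_closure_le {H : Subgroup F} (hH : H.FG) (T : Finset F)
    (hT : (T : Set F) ⊆ depSet H) :
    Finite (IsFreeGroup.Generators ↥(H ⊔ Subgroup.closure (T : Set F))) ∧
      Nat.card (IsFreeGroup.Generators ↥(H ⊔ Subgroup.closure (T : Set F))) ≤
        Nat.card (IsFreeGroup.Generators H) := by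
  classical
  induction T using Finset.induction_on with
  | empty =>
    rw [Finset.coe_empty, Subgroup.closure_empty, sup_bot_eq]
    have : Group.FG H := (Group.fg_iff_subgroup_fg H).2 hH
    exact ⟨IsFreeGroup.finite_generators H, le_rfl⟩
  | insert g T _ ih =>
    rw [Finset.coe_insert, Set.insert_subset_iff] at hT
    obtain ⟨hfin, hle⟩ := ih hT.2
    have hrange : H ⊔ Subgroup.closure ((insert g T : Finset F) : Set F) =
        (evalHom (H ⊔ Subgroup.closure (T : Set F)) g).range := by
      rw [range_evalHom, sup_assoc, ← Subgroup.closure_union, Set.union_singleton,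
        Finset.coe_insert]
    rw [hrange]
    obtain ⟨hfin', hle'⟩ := (DependsOn.mono hH le_sup_left hT.1).card_le
      (IsFreeGroup.basis ↥(H ⊔ Subgroup.closure (T : Set F))) (IsFreeGroup.basis _)
    exact ⟨hfin', hle'.trans hle⟩

/-- Every finite part of a basis of `Dep H` has at most `rk H` elements: it lies in some
`⟨H, g₁, …, gₖ⟩` with the `gᵢ` dependent on `H`, and the retraction of `Dep H` onto the free factor
it spans maps this subgroup onto that factor. -/
theorem card_finset_generators_dep_le {H : Subgroup F} (hH : H.FG)
    (s : Finset (IsFreeGroup.Generators (Dep H))) :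
    s.card ≤ Nat.card (IsFreeGroup.Generators H) := by
  classical
  let b := IsFreeGroup.basis (Dep H)
  choose T hT hxT using fun i => Subgroup.exists_finset_mem_closure (b i).2
  let U : Finset F := s.biUnion T
  have hU : (U : Set F) ⊆ depSet H := by
    intro x hx
    obtain ⟨i, _, hi⟩ := Finset.mem_biUnion.1 (Finset.mem_coe.1 hx)
    exact hT i hi
  obtain ⟨hfin, hle⟩ := card_generators_sup_closure_le hH U hU
  have hK : H ⊔ Subgroup.closure (U : Set F) ≤ Dep H :=
    sup_le (le_dep H) (Subgroup.closure_mono hU)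
  let r : Dep H →* FreeGroup s :=
    b.lift fun i => if h : i ∈ s then FreeGroup.of ⟨i, h⟩ else 1
  have hr : Function.Surjective (r.comp (Subgroup.inclusion hK)) := by
    rw [← MonoidHom.range_eq_top, eq_top_iff, ← FreeGroup.closure_range_of, Subgroup.closure_le]
    rintro _ ⟨i, rfl⟩
    have hi : (b i.1 : F) ∈ H ⊔ Subgroup.closure (U : Set F) :=
      Subgroup.mem_sup_right
        (Subgroup.closure_mono (Finset.coe_subset.2 (Finset.subset_biUnion_of_mem T i.2)) (hxT i.1))
    refine ⟨⟨b i.1, hi⟩, ?_⟩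
    have : Subgroup.inclusion hK ⟨b i.1, hi⟩ = b i.1 := rfl
    rw [MonoidHom.comp_apply, this]
    simp [r]
  have := ((IsFreeGroup.basis _).card_le_of_surjective (FreeGroupBasis.ofFreeGroup s) hr).2
  rw [Nat.card_eq_fintype_card, Fintype.card_coe] at this
  exact this.trans hle

end FreeDependence

theorem proposition2p2 {F : Type*} [Group F] [IsFreeGroup F] (H : Subgroup F) (hH : H.FG) :
    FreeDependence.rk (FreeDependence.Dep H) ≤ FreeDependence.rk H := by
  have : Group.FG H := (Group.fg_iff_subgroup_fg H).2 hH
  have hfin := IsFreeGroup.finite_generators H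
  rw [FreeDependence.rk, FreeDependence.rk, ← Nat.cast_card (α := IsFreeGroup.Generators H)]
  exact Cardinal.card_le_of (FreeDependence.card_finset_generators_dep_le hH)
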